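/- **Setting.** A tree is a partially ordered set $(T,\preceq)$ in which, for every node $a$, the set $\{b: b\prec a\}$ is finite and linearly ordered; the level of $a$ is $\ell(a)=|\{b:b\prec a\}|$, and $T(i)$, $T(<i)$, $T(\le i)$ are the sets of nodes of level $=i$, $<i$, $\le i$. An $\mathcal S$-tree $(T,\preceq,\Sigma,\mathcal S)$ is a countable finitely branching tree with finitely many nodes of level $0$, a set $\Sigma$, and a partial function $\mathcal S\colon T\times T^{<\omega}\times\Sigma\to T$ such that * (S1) if $\mathcal S(a,\bar p,c)$ is defined, then it is an immediate successor of $a$ and all entries of $\bar p$ have level at most $\ell(a)-1$; * (S2) if $\mathcal S(a,\bar p,c)=\mathcal S(b,\bar q,d)$, then $a=b$, $\bar p=\bar q$, $c=d$; * (S3) every immediate successor $b$ of a node $a$ equals $\mathcal S(a,\bar p,c)$ for some $\bar p$ and $c$. An injection $F\colon T\to T$ is shape-preserving if (i) $\ell(a)=\ell(b)$ implies $\ell(F(a))=\ell(F(b))$; (ii) whenever $\mathcal S(a,\bar p,c)$ is defined, $\mathcal S(F(a),F(\bar p),c)$ is defined and $\mathcal S(F(a),F(\bar p),c)\preceq F(\mathcal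 S(a,\bar p,c))$; (iii) $a\in T(0)$ and $a\preceq b$ imply $a\preceq F(b)$. For a function $f$ satisfying (i) on its domain, $\tilde f(i)$ is the level of $f(a)$ for any $a$ of level $i$ in its domain. $F$ skips level $m$ if $m$ is not a value of $\tilde F$, and skips only level $m$ if the set of values of $\tilde F$ is $\omega\setminus\{m\}$. An $(\mathcal S,\mathcal M)$-tree is an $\mathcal S$-tree with a set $\mathcal M$ of shape-preserving functions $T\to T$ such that * (M1) $\mathcal M$ contains the identity and is closed under composition, and for every sequence $(F_i)_{i\in\omega}$ in $\mathcal M$ with $F_i\restriction_{T(\le i)}=F_{i+1}\restriction_{T(\le i)}$ for all $i$ there is $F_\infty\in\mathcal M$ with $F_\infty\restriction_{T(\le i)}=F_i\restriction_{T(\le i)}$ for all $i$; * (M2) for every $n\in\omega$ and every $F\in\mathcal M$ with $\tilde F(n)>0$ that skips level $\tilde F(n)-1$ there are $F_1,F_2\in\mathcal M$ such that $F_2$ skips only level $\tilde F(n)-1$ and $F_2\circ F_1\restriction_{T(\le n)}=F\restriction_{T(\le n)}$; * (M3) for all $n<m$ there is $F^n_m\in\mathcal M$ skipping only level $m$ such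 that $F^n_m(b)=\mathcal S(b,\bar p,c)$ whenever $a\in T(n)$, $b\in T(m)$, $\mathcal S(a,\bar p,c)$ is defined and $\mathcal S(a,\bar p,c)\preceq b$. Let $\mathcal{AM}^n_k$ be the set of restrictions $F\restriction_{T(<n+k)}$ of those $F\in\mathcal M$ that are the identity on $T(<n)$, and, for $n+k>0$, let $\mathcal{AM}^n_k(j)=\{f\in\mathcal{AM}^n_k:\tilde f(n+k-1)=j\}$. **Corollary.** Let $(T,\preceq,\Sigma,\mathcal S,\mathcal M)$ be an $(\mathcal S,\mathcal M)$-tree. Then for all $n,k,m,r\in\omega$ with $n+k>0$ and $n+m>0$ there exists $N\in\omega$ such that for every $r$-colouring $\chi\colon\mathcal{AM}^n_k(N)\to r$ there exists $F\in\mathcal{AM}^n_m(N)$ such that, for every $g\in\mathcal{AM}^n_k(n+m-1)$, the composition $F\circ g$ is defined and belongs to $\mathcal{AM}^n_k(N)$, and $\chi$ is constant on $$\{F\circ g: g\in\mathcal{AM}^n_k(n+m-1)\}.$$ -/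

import Mathlib

namespace ShapeRamsey

universe u v

/-- The level `ℓ(a)` of a node: the number of its strict predecessors. -/
noncomputable def level {T : Type u} [PartialOrder T] (a : T) : ℕ := (Set.Iio a).ncard

/-- The part `T(<k)` of a tree below level `k`. -/
abbrev Below (T : Type u) [PartialOrder T] (k : ℕ) : Type u := {a : T // level a < k}

/-- An `S`-tree on a partially ordered set `T` with alphabet `A`. The successor operation is a
partial function: `succ a p c = some b` means that it is defined at `(a, p, c)` with value `b`. -/
structure STree (T : Type u) [PartialOrder T] (A : Type v) where
  /-- the successor operation, applied to a base, a parameter and a character -/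
  succ : T → List T → A → Option T
  finite_Iio : ∀ a : T, (Set.Iio a).Finite
  chain_Iio : ∀ a : T, IsChain (· ≤ ·) (Set.Iio a)
  countable : Countable T
  finite_branching : ∀ a : T, {b : T | a ⋖ b}.Finite
  finite_roots : {a : T | level a = 0}.Finite
  covBy_of_succ : ∀ a p c b, succ a p c = some b → a ⋖ b
  level_param_lt : ∀ a p c b, succ a p c = some b → ∀ q ∈ p, level q < level a
  injective : ∀ a p c a' p' c' b, succ a p c = some b → succ a' p' c' = some b →
    a = a' ∧ p = p' ∧ c = c'
  constructive : ∀ a b : T, a ⋖ b → ∃ p c, succ a p c = some b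

variable {T : Type u} [PartialOrder T] {A : Type v}

/-- Shape-preserving functions `T → T`. -/
structure STree.IsShapePreserving (S : STree T A) (F : T → T) : Prop where
  injective : Function.Injective F
  level_preserving : ∀ a b : T, level a = level b → level (F a) = level (F b)
  weakly_preserving : ∀ a p c b, S.succ a p c = some b →
    ∃ b', S.succ (F a) (p.map F) c = some b' ∧ b' ≤ F b
  root_preserving : ∀ a b : T, level a = 0 → a ≤ b → a ≤ F b

/-- The graph of the level function of `F : T → T`: some node of level `i` is mapped to level `j`. -/
def LevelMap (F : T → T) (i j : ℕ) : Prop := ∃ a : T, level a = i ∧ level (F a) = j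

/-- `F` skips level `m`. -/
def Skips (F : T → T) (m : ℕ) : Prop := ∀ i, ¬ LevelMap F i m

/-- `F` skips only level `m`: the levels reached by `F` are exactly the levels other than `m`. -/
def SkipsOnly (F : T → T) (m : ℕ) : Prop := {j : ℕ | ∃ i, LevelMap F i j} = {m}ᶜ

/-- An `(S, M)`-tree. -/
structure SMTree (T : Type u) [PartialOrder T] (A : Type v) extends STree T A where
  /-- the monoid of shape-preserving functions -/
  M : Set (T → T)
  shape_preserving : ∀ F ∈ M, toSTree.IsShapePreserving F
  id_mem : id ∈ M
  comp_mem : ∀ F ∈ M, ∀ F' ∈ M, F ∘ F' ∈ M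
  limit_mem : ∀ F : ℕ → T → T, (∀ i, F i ∈ M) →
    (∀ i, ∀ a : T, level a ≤ i → F i a = F (i + 1) a) →
    ∃ G ∈ M, ∀ i, ∀ a : T, level a ≤ i → G a = F i a
  decomposition : ∀ n j : ℕ, ∀ F ∈ M, LevelMap F n (j + 1) → Skips F j →
    ∃ F₁ ∈ M, ∃ F₂ ∈ M, SkipsOnly F₂ j ∧ ∀ a : T, level a ≤ n → F₂ (F₁ a) = F a
  duplication : ∀ n m : ℕ, n < m → ∃ F ∈ M, SkipsOnly F m ∧
    ∀ a b : T, level a = n → level b = m → ∀ p c s, succ a p c = some s → s ≤ b →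
      succ b p c = some (F b)

/-- The set `M^n` of the members of `M` that are the identity on `T(<n)`. -/
def SMTree.MFix (S : SMTree T A) (n : ℕ) : Set (T → T) :=
  {F | F ∈ S.M ∧ ∀ a : T, level a < n → F a = a}

/-- The set `AM^n_k` of the restrictions of members of `M^n` to `T(<n+k)`. -/
def SMTree.AM (S : SMTree T A) (n k : ℕ) : Set (Below T (n + k) → T) :=
  {f | ∃ F ∈ S.MFix n, ∀ a : Below T (n + k), f a = F a}

/-- The set `AM^n_k(m)` of those `f ∈ AM^n_k` that map the top level `n + k - 1` of their domain
to level `m`. -/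
def SMTree.AMAt (S : SMTree T A) (n k m : ℕ) : Set (Below T (n + k) → T) :=
  {f | f ∈ S.AM n k ∧ ∃ a : Below T (n + k), level a.1 + 1 = n + k ∧ level (f a) = m}

end ShapeRamsey

/-!
Call a function in `M` tight above level `n` if it skips no level above the image of level `n`.
By (M2), the restriction of any `F ∈ M` to `T(≤n)` extends to a function tight above level `n`. Such
an extension is determined level by level, because shape preservation prescribes the immediate
successors of its values; so every `F'` agreeing with `F` on `T(≤n)` factors, up to any given level,
through the tight extension, and the other factor fixes all levels `≤ F̃(n)`.

For `AM^n_1(n+1)`, regard each `g` as a letter. Words of letters are realised by iterating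
duplications (M3), each appending one more letter to the image of level `n`; a word with a variable
is realised by an `F ∈ M^n` such that `F ∘ g` is the word with `g` substituted, and the
Hales–Jewett theorem makes all `F ∘ g` the same colour. Splitting a map and commuting the pieces as
`F ∘ G = G' ∘ F` extends this to `AM^n_1(M)` for all `M`, and pigeonholing over levels gives one
colour for all of `AM^n_1(i)`, `i < m`, at once.

For `k ≥ 2`, treating the possible levels of the image of level `n` in turn and using the theorem
for `k - 1` above each, the factorization produces a copy on which the colour of `f ∈ AM^n_k`
depends only on the restriction of `f` to `T(≤n)`. The case `k = 1` then finishes the induction on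
`k`.
-/

namespace ShapeRamsey

variable {T : Type*} [PartialOrder T] {A : Type*}

/-- The restriction of `F` to `T(<n)`. -/
def restr (n : ℕ) (F : T → T) : Below T n → T := fun a => F a

/-- The inclusion of `T(<m)` in `T(<n)`. -/
def Below.castLE {m n : ℕ} (h : m ≤ n) (a : Below T m) : Below T n := ⟨a, a.2.trans_le h⟩

theorem restr_eq_iff {n : ℕ} {F G : T → T} :
    restr n F = restr n G ↔ ∀ a, level a < n → F a = G a := by
  simp only [funext_iff, restr, Subtype.forall]

theorem restr_eq_mono {m n : ℕ} {F G : T → T} (h : restr n F = restr n G) (hmn : m ≤ n) :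
    restr m F = restr m G :=
  congrArg (· ∘ Below.castLE hmn) h

theorem restr_comp_left_congr {n : ℕ} {F G : T → T} (H : T → T) (h : restr n F = restr n G) :
    restr n (H ∘ F) = restr n (H ∘ G) :=
  congrArg (H ∘ ·) h

theorem restr_succ_eq_iff {n : ℕ} {F G : T → T} :
    restr (n + 1) F = restr (n + 1) G ↔
      restr n F = restr n G ∧ ∀ a, level a = n → F a = G a := by
  simp only [restr_eq_iff, Nat.lt_succ_iff_lt_or_eq, or_imp, forall_and]

namespace STree

section level

variable (S : STree T A)

include S

theorem level_strictMono : StrictMono (level : T → ℕ) := fun _ b h =>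
  Set.ncard_lt_ncard (Set.Iio_ssubset_Iio h) (S.finite_Iio b)

theorem eq_of_le_of_level_le {a b : T} (h : a ≤ b) (hl : level b ≤ level a) : a = b :=
  h.eq_of_not_lt fun hlt => (S.level_strictMono hlt).not_ge hl

theorem le_of_lt_of_covBy {a b x : T} (hab : a < b) (hxb : x ⋖ b) : a ≤ x := by
  rcases (S.chain_Iio b).total hab hxb.lt with h | h
  · exact h
  · exact (h.eq_of_not_lt fun hxa => hxb.2 hxa hab).ge

theorem level_of_covBy {a b : T} (h : a ⋖ b) : level b = level a + 1 := by
  have hIio : Set.Iio b = insert a (Set.Iio a) := by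
    rw [Set.Iio_insert]
    exact Set.Subset.antisymm (fun _ hc => S.le_of_lt_of_covBy hc h) fun _ hc => hc.trans_lt h.lt
  rw [level, hIio, Set.ncard_insert_of_notMem Set.self_notMem_Iio (S.finite_Iio a), level]

theorem exists_covBy {b : T} (h : 0 < level b) : ∃ a, a ⋖ b := by
  obtain ⟨a, ha⟩ := (S.finite_Iio b).exists_maximal (Set.nonempty_of_ncard_ne_zero h.ne')
  exact ⟨a, ha.prop, fun c hac hcb => (ha.2 hcb hac.le).not_gt hac⟩

theorem exists_le_level_eq {b : T} {i : ℕ} (h : i ≤ level b) : ∃ a ≤ b, level a = i := by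
  obtain ⟨d, hd⟩ := Nat.exists_eq_add_of_le h
  induction d generalizing b with
  | zero => exact ⟨b, le_rfl, hd⟩
  | succ d ih =>
    obtain ⟨x, hxb⟩ := S.exists_covBy (b := b) (by omega)
    have hx := S.level_of_covBy hxb
    obtain ⟨a, hax, ha⟩ := ih (b := x) (by omega) (by omega)
    exact ⟨a, hax.trans hxb.le, ha⟩

theorem eq_of_le_of_le_of_level_eq {a a' b : T} (h : a ≤ b) (h' : a' ≤ b)
    (hl : level a = level a') : a = a' := by
  rcases h.eq_or_lt with rfl | h
  · exact (S.eq_of_le_of_level_le h' hl.le).symm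
  rcases h'.eq_or_lt with rfl | h'
  · exact S.eq_of_le_of_level_le h.le hl.ge
  rcases (S.chain_Iio b).total h h' with haa' | haa'
  · exact S.eq_of_le_of_level_le haa' hl.ge
  · exact (S.eq_of_le_of_level_le haa' hl.le).symm

theorem finite_level_eq (i : ℕ) : {a : T | level a = i}.Finite := by
  induction i with
  | zero => exact S.finite_roots
  | succ i ih =>
    refine (ih.biUnion fun a _ => S.finite_branching a).subset fun b (hb : level b = i + 1) => ?_
    obtain ⟨a, hab⟩ := S.exists_covBy (b := b) (by omega)
    have ha := S.level_of_covBy hab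
    exact Set.mem_biUnion (show level a = i by omega) hab

theorem finite_below (n : ℕ) : Finite (Below T n) :=
  ((Set.finite_Iio n).biUnion fun i _ => S.finite_level_eq i).subset
    fun a (ha : level a < n) => Set.mem_biUnion (show level a ∈ Set.Iio n from ha) rfl

end level

variable {S : STree T A} {F G : T → T} {a b : T} {p : List T} {c : A}

theorem exists_succ_eq (S : STree T A) (h : 0 < level b) : ∃ a p c, S.succ a p c = some b := by
  obtain ⟨a, hab⟩ := S.exists_covBy h
  exact ⟨a, S.constructive a b hab⟩

theorem level_of_succ (h : S.succ a p c = some b) : level b = level a + 1 :=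
  S.level_of_covBy (S.covBy_of_succ _ _ _ _ h)

theorem map_param_congr (h : S.succ a p c = some b) (hFG : restr (level a) F = restr (level a) G) :
    p.map F = p.map G :=
  List.map_congr_left fun q hq => restr_eq_iff.1 hFG q (S.level_param_lt _ _ _ _ h q hq)

namespace IsShapePreserving

theorem lt_of_covBy (hF : S.IsShapePreserving F) (h : a ⋖ b) : F a < F b := by
  obtain ⟨p, c, hs⟩ := S.constructive a b h
  obtain ⟨b', hb', hle⟩ := hF.weakly_preserving a p c b hs
  exact (S.covBy_of_succ _ _ _ _ hb').lt.trans_le hle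

theorem strictMono (hF : S.IsShapePreserving F) : StrictMono F := by
  intro a b hab
  obtain ⟨l, hl⟩ : ∃ l, level b = l := ⟨_, rfl⟩
  induction l generalizing b with
  | zero => exact absurd (S.level_strictMono hab) (by omega)
  | succ l ih =>
    obtain ⟨x, hxb⟩ := S.exists_covBy (b := b) (by omega)
    have hFx : F x < F b := hF.lt_of_covBy hxb
    rcases (S.le_of_lt_of_covBy hab hxb).eq_or_lt with rfl | hax
    · exact hFx
    · have hx := S.level_of_covBy hxb
      exact (ih hax (by omega)).trans hFx

theorem succ_map (hF : S.IsShapePreserving F) (h : S.succ a p c = some b)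
    (hl : level (F b) = level (F a) + 1) : S.succ (F a) (p.map F) c = some (F b) := by
  obtain ⟨b', hb', hle⟩ := hF.weakly_preserving a p c b h
  rw [hb', S.eq_of_le_of_level_le hle (by rw [hl, level_of_succ hb'])]

theorem eq_of_covBy (hF : S.IsShapePreserving F) (hG : S.IsShapePreserving G) (hab : a ⋖ b)
    (hFG : restr (level b) F = restr (level b) G) (hFl : level (F b) = level (F a) + 1)
    (hGl : level (G b) = level (G a) + 1) : F b = G b := by
  obtain ⟨p, c, hs⟩ := S.constructive a b hab
  have ha : level a < level b := S.level_strictMono hab.lt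
  have hFb := hF.succ_map hs hFl
  rw [restr_eq_iff.1 hFG a ha, map_param_congr hs (restr_eq_mono hFG ha.le),
    hG.succ_map hs hGl] at hFb
  exact (Option.some.inj hFb).symm

theorem le_map (hF : S.IsShapePreserving F) (h : restr (level b) F = restr (level b) id) :
    b ≤ F b := by
  rcases (level b).eq_zero_or_pos with h0 | h0
  · exact hF.root_preserving b b h0 le_rfl
  obtain ⟨a, p, c, hs⟩ := S.exists_succ_eq h0
  have ha : level a < level b := by rw [level_of_succ hs]; omega
  obtain ⟨b', hb', hle⟩ := hF.weakly_preserving a p c b hs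
  rw [restr_eq_iff.1 h a ha, map_param_congr hs (restr_eq_mono h ha.le), List.map_id, id, hs] at hb'
  exact (Option.some.inj hb').trans_le hle

end IsShapePreserving

end STree

namespace SMTree

section levelFun

theorem exists_level_eq (S : SMTree T A) (i : ℕ) : ∃ a : T, level a = i := by
  obtain ⟨F, -, hF, -⟩ := S.duplication 0 1 one_pos
  obtain ⟨_, a, -, ha⟩ : i + 2 ∈ {j | ∃ i, LevelMap F i j} := by
    rw [show {j | ∃ i, LevelMap F i j} = {1}ᶜ from hF]
    simp
  obtain ⟨b, -, hb⟩ := S.exists_le_level_eq (b := F a) (i := i) (by omega)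
  exact ⟨b, hb⟩

/-- The function `F̃` giving the level of `F a` in terms of the level of `a`. It is computed at an
arbitrary node of level `i`, so it is meaningful only for level preserving `F`. -/
noncomputable def levelFun (S : SMTree T A) (F : T → T) (i : ℕ) : ℕ :=
  level (F (S.exists_level_eq i).choose)

variable {S : SMTree T A} {F G : T → T} {m n i j : ℕ}

theorem level_apply (hF : F ∈ S.M) (a : T) : level (F a) = S.levelFun F (level a) :=
  (S.shape_preserving F hF).level_preserving _ _ (S.exists_level_eq (level a)).choose_spec.symm

theorem levelFun_id (i : ℕ) : S.levelFun id i = i := (S.exists_level_eq i).choose_spec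

theorem levelFun_comp (hF : F ∈ S.M) (i : ℕ) :
    S.levelFun (F ∘ G) i = S.levelFun F (S.levelFun G i) :=
  level_apply hF _

theorem levelFun_congr (h : restr n F = restr n G) (hi : i < n) :
    S.levelFun F i = S.levelFun G i := by
  rw [levelFun, levelFun, restr_eq_iff.1 h]
  rwa [(S.exists_level_eq i).choose_spec]

theorem levelFun_strictMono (hF : F ∈ S.M) : StrictMono (S.levelFun F) := by
  intro i j hij
  obtain ⟨b, rfl⟩ := S.exists_level_eq j
  obtain ⟨a, hab, rfl⟩ := S.exists_le_level_eq hij.le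
  rw [← level_apply hF, ← level_apply hF]
  exact S.level_strictMono ((S.shape_preserving F hF).strictMono (hab.lt_of_ne (by grind)))

theorem le_levelFun (hF : F ∈ S.M) (i : ℕ) : i ≤ S.levelFun F i :=
  (levelFun_strictMono hF).le_apply

theorem levelMap_iff (hF : F ∈ S.M) : LevelMap F i j ↔ S.levelFun F i = j := by
  constructor
  · rintro ⟨a, rfl, rfl⟩
    exact (level_apply hF a).symm
  · rintro rfl
    exact ⟨_, (S.exists_level_eq i).choose_spec, rfl⟩

theorem skips_of_gap (hF : F ∈ S.M) (hlt : j < S.levelFun F n)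
    (hgt : ∀ i < n, S.levelFun F i < j) : Skips F j := by
  intro i hi
  rw [levelMap_iff hF] at hi
  rcases lt_or_ge i n with hin | hni
  · exact (hgt i hin).ne hi
  · exact (hlt.trans_le ((levelFun_strictMono hF).monotone hni)).ne' hi

theorem levelFun_eq_of_skipsOnly (hF : F ∈ S.M) (h : SkipsOnly F m) (i : ℕ) :
    S.levelFun F i = if i < m then i else i + 1 := by
  have hmono : StrictMono fun i : ℕ => if i < m then i else i + 1 := by
    intro a b hab
    dsimp only
    split_ifs <;> omega
  refine congrFun (((levelFun_strictMono hF).range_inj hmono).1 ?_) i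
  calc Set.range (S.levelFun F) = {m}ᶜ := by
        rw [← h]
        simp only [levelMap_iff hF, Set.range]
    _ = Set.range fun i : ℕ => if i < m then i else i + 1 := by
        ext j
        rw [Set.mem_compl_singleton_iff, Set.mem_range]
        refine ⟨fun hj => ⟨if j < m then j else j - 1, ?_⟩, ?_⟩
        · grind
        · grind

theorem restr_add_two_congr (hF : F ∈ S.M) (hG : G ∈ S.M) (h : restr (i + 1) F = restr (i + 1) G)
    (hFi : S.levelFun F (i + 1) = S.levelFun F i + 1)
    (hGi : S.levelFun G (i + 1) = S.levelFun G i + 1) : restr (i + 2) F = restr (i + 2) G := by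
  refine restr_succ_eq_iff.2 ⟨h, fun b hb => ?_⟩
  obtain ⟨a, hab⟩ := S.exists_covBy (b := b) (by omega)
  have ha : level a = i := by have := S.level_of_covBy hab; omega
  refine (S.shape_preserving F hF).eq_of_covBy (S.shape_preserving G hG) hab (hb ▸ h) ?_ ?_
  · rw [level_apply hF, level_apply hF, ha, hb, hFi]
  · rw [level_apply hG, level_apply hG, ha, hb, hGi]

end levelFun

section MFix

variable {S : SMTree T A} {F G : T → T} {m n p : ℕ}

theorem restr_eq_restr_id (hF : F ∈ S.MFix n) : restr n F = restr n id :=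
  restr_eq_iff.2 hF.2

theorem le_apply_of_mem_MFix (hF : F ∈ S.MFix n) {a : T} (ha : level a ≤ n) : a ≤ F a :=
  (S.shape_preserving F hF.1).le_map (restr_eq_mono (restr_eq_restr_id hF) ha)

theorem mem_MFix_iff_levelFun (hF : F ∈ S.M) : F ∈ S.MFix n ↔ ∀ i < n, S.levelFun F i = i := by
  constructor
  · intro h i hi
    rw [levelFun_congr (restr_eq_restr_id h) hi, levelFun_id]
  intro h
  induction n with
  | zero => exact ⟨hF, fun a ha => absurd ha (Nat.not_lt_zero _)⟩
  | succ n ih =>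
    have hFn : F ∈ S.MFix n := ih fun i hi => h i (hi.trans n.lt_succ_self)
    refine ⟨hF, fun a ha => (S.eq_of_le_of_level_le
      (le_apply_of_mem_MFix hFn (Nat.le_of_lt_succ ha)) ?_).symm⟩
    rw [level_apply hF, h _ ha]

theorem levelFun_of_mem_MFix {i : ℕ} (hF : F ∈ S.MFix n) (hi : i < n) : S.levelFun F i = i :=
  (mem_MFix_iff_levelFun hF.1).1 hF i hi

theorem mem_MFix_succ_of_levelFun_eq (hF : F ∈ S.M) (h : S.levelFun F n = n) :
    F ∈ S.MFix (n + 1) := by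
  refine (mem_MFix_iff_levelFun hF).2 fun i hi => ?_
  have hle := (levelFun_strictMono hF).add_le_nat (n - i) i
  have hi' := le_levelFun hF i
  rw [Nat.sub_add_cancel (Nat.le_of_lt_succ hi), h] at hle
  omega

theorem MFix_anti (h : m ≤ n) : S.MFix n ⊆ S.MFix m :=
  fun _ hF => ⟨hF.1, fun a ha => hF.2 a (ha.trans_le h)⟩

theorem id_mem_MFix (n : ℕ) : id ∈ S.MFix n := ⟨S.id_mem, fun _ _ => rfl⟩

theorem comp_mem_MFix (hF : F ∈ S.MFix n) (hG : G ∈ S.MFix n) : F ∘ G ∈ S.MFix n :=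
  ⟨S.comp_mem F hF.1 G hG.1, fun a ha => by rw [Function.comp_apply, hG.2 a ha, hF.2 a ha]⟩

theorem mem_MFix_of_restr_eq (hF : F ∈ S.MFix n) (hG : G ∈ S.M) (h : restr n F = restr n G) :
    G ∈ S.MFix n :=
  ⟨hG, restr_eq_iff.1 (h.symm.trans (restr_eq_restr_id hF))⟩

theorem restr_comp_of_mem_MFix (hF : F ∈ S.M) (hG : G ∈ S.MFix p)
    (h : ∀ i < n, S.levelFun F i < p) : restr n (G ∘ F) = restr n F :=
  restr_eq_iff.2 fun a ha => hG.2 (F a) (by rw [level_apply hF]; exact h _ ha)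

theorem restr_eq_of_restr_succ_eq_comp {F' : T → T} (hF' : F' ∈ S.M) (hG : G ∈ S.MFix p)
    (hp : S.levelFun F' n = p) (h : restr (n + 1) F = restr (n + 1) (G ∘ F')) :
    restr n F = restr n F' :=
  (restr_eq_mono h n.le_succ).trans <|
    restr_comp_of_mem_MFix hF' hG fun _ hi => hp ▸ levelFun_strictMono hF' hi

end MFix

section Factorization

/-- `F` skips no level above `F̃(n)`. -/
def IsTight (S : SMTree T A) (n : ℕ) (F : T → T) : Prop :=
  ∀ i, S.levelFun F (n + i) = S.levelFun F n + i

variable {S : SMTree T A} {F G E : T → T} {n p : ℕ}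

theorem isTight_id (n : ℕ) : S.IsTight n id := fun i => by rw [levelFun_id, levelFun_id]

theorem IsTight.succ (h : S.IsTight n F) : S.IsTight (n + 1) F := fun i => by
  rw [h 1, add_assoc, h, add_assoc]

theorem IsTight.comp (hG : G ∈ S.M) (hGt : S.IsTight (S.levelFun F n) G) (hFt : S.IsTight n F) :
    S.IsTight n (G ∘ F) := fun i => by
  rw [levelFun_comp hG, hFt, hGt, levelFun_comp hG]

theorem exists_decomp_of_skips {j : ℕ} (hF : F ∈ S.M) (hj : S.levelFun F n = j + 1)
    (hs : Skips F j) : ∃ G ∈ S.MFix j, S.IsTight j G ∧ ∃ F' ∈ S.M, S.levelFun F' n = j ∧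
      restr (n + 1) F = restr (n + 1) (G ∘ F') := by
  obtain ⟨F', hF', G, hG, hGs, hGF'⟩ := S.decomposition n j F hF ((levelMap_iff hF).2 hj) hs
  have hlv : ∀ i, S.levelFun G i = if i < j then i else i + 1 := levelFun_eq_of_skipsOnly hG hGs
  have hrestr : restr (n + 1) F = restr (n + 1) (G ∘ F') :=
    restr_eq_iff.2 fun a ha => (hGF' a (Nat.le_of_lt_succ ha)).symm
  refine ⟨G, (mem_MFix_iff_levelFun hG).2 fun i hi => by rw [hlv, if_pos hi], fun i => ?_,
    F', hF', ?_, hrestr⟩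
  · rw [hlv, hlv, if_neg (by omega), if_neg (by omega)]
    omega
  · have hn := levelFun_congr (S := S) hrestr n.lt_succ_self
    rw [levelFun_comp hG, hlv, hj] at hn
    split_ifs at hn <;> omega

theorem exists_decomp (hF : F ∈ S.M) (hp : p ≤ S.levelFun F n)
    (hlt : ∀ i < n, S.levelFun F i < p) : ∃ G ∈ S.MFix p, S.IsTight p G ∧ ∃ F' ∈ S.M,
      S.levelFun F' n = p ∧ restr (n + 1) F = restr (n + 1) (G ∘ F') := by
  obtain ⟨d, hd⟩ := Nat.exists_eq_add_of_le hp
  induction d generalizing F with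
  | zero => exact ⟨id, id_mem_MFix p, isTight_id p, F, hF, hd, rfl⟩
  | succ d ih =>
    have hskip : Skips F (p + d) :=
      skips_of_gap hF (n := n) (by omega) fun i hi => (hlt i hi).trans_le (Nat.le_add_right p d)
    obtain ⟨G₁, hG₁, hG₁t, F₁, hF₁, hF₁n, hFG₁⟩ := exists_decomp_of_skips (j := p + d) hF hd hskip
    have hF₁lt : ∀ i < n, S.levelFun F₁ i < p := by
      intro i hi
      rw [← levelFun_congr (restr_eq_of_restr_succ_eq_comp hF₁ hG₁ hF₁n hFG₁) hi]
      exact hlt i hi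
    obtain ⟨G₂, hG₂, hG₂t, F', hF', hF'n, hFG₂⟩ := ih hF₁ (by omega) hF₁lt hF₁n
    have hG₂p : S.levelFun G₂ p = p + d := by
      rw [← hF₁n, levelFun_congr hFG₂ n.lt_succ_self, levelFun_comp hG₂.1, hF'n]
    exact ⟨G₁ ∘ G₂, comp_mem_MFix (MFix_anti (Nat.le_add_right p d) hG₁) hG₂,
      (hG₂p ▸ hG₁t).comp hG₁.1 hG₂t, F', hF', hF'n, hFG₁.trans (restr_comp_left_congr G₁ hFG₂)⟩

theorem exists_factor (hF : F ∈ S.M) (hE : E ∈ S.M) (hFE : restr (n + 1) F = restr (n + 1) E)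
    (hEt : S.IsTight n E) (k : ℕ) : ∃ H ∈ S.MFix (S.levelFun F n + 1),
      S.IsTight (S.levelFun F n + k) H ∧ restr (n + k + 1) F = restr (n + k + 1) (H ∘ E) := by
  have hEn : ∀ i, S.levelFun E (n + i) = S.levelFun F n + i := fun i => by
    rw [hEt, levelFun_congr hFE n.lt_succ_self]
  induction k with
  | zero => exact ⟨id, id_mem_MFix _, isTight_id _, hFE⟩
  | succ k ih =>
    obtain ⟨H, hH, hHt, hFH⟩ := ih
    have hHk : S.levelFun H (S.levelFun F n + k) = S.levelFun F (n + k) := by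
      rw [levelFun_congr hFH (n + k).lt_succ_self, levelFun_comp hH.1, hEn]
    obtain ⟨G, hG, hGt, F', hF', hF'n, hFG⟩ := exists_decomp hF (n := n + k + 1)
      (p := S.levelFun F (n + k) + 1) (levelFun_strictMono hF (n + k).lt_succ_self)
      fun i hi => Nat.lt_succ_of_le ((levelFun_strictMono hF).monotone (Nat.le_of_lt_succ hi))
    have hF'F : restr (n + k + 1) F' = restr (n + k + 1) F :=
      (restr_eq_of_restr_succ_eq_comp hF' hG hF'n hFG).symm
    have hF'HE : restr (n + k + 2) F' = restr (n + k + 2) (H ∘ E) := by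
      refine restr_add_two_congr hF' (S.comp_mem H hH.1 E hE) (hF'F.trans hFH) ?_ ?_
      · rw [hF'n, levelFun_congr hF'F (n + k).lt_succ_self]
      · rw [levelFun_comp hH.1, levelFun_comp hH.1, add_assoc, hEn, hEn, ← add_assoc, hHt 1]
    have hle : S.levelFun F n ≤ S.levelFun F (n + k) :=
      (levelFun_strictMono hF).monotone (Nat.le_add_right n k)
    have hHk' : S.levelFun H (S.levelFun F n + (k + 1)) = S.levelFun F (n + k) + 1 := by
      rw [← add_assoc, hHt 1, hHk]
    exact ⟨G ∘ H, comp_mem_MFix (MFix_anti (by omega) hG) hH, (hHk'.symm ▸ hGt).comp hG.1 hHt.succ,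
      hFG.trans (restr_comp_left_congr G hF'HE)⟩

theorem exists_tight (hF : F ∈ S.M) (n : ℕ) :
    ∃ E ∈ S.M, S.IsTight n E ∧ restr (n + 1) F = restr (n + 1) E := by
  obtain ⟨E, hE, hEt, F', hF', hF'0, hFE⟩ :=
    exists_decomp hF (n := 0) (Nat.zero_le _) fun i hi => absurd hi (Nat.not_lt_zero i)
  have hF'id : restr 1 F' = restr 1 id :=
    restr_eq_restr_id (mem_MFix_succ_of_levelFun_eq hF' hF'0)
  have hFE : restr 1 F = restr 1 E := hFE.trans (restr_comp_left_congr E hF'id)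
  obtain ⟨H, hH, hHt, hFH⟩ := exists_factor hF hE.1 hFE hEt n
  rw [zero_add] at hFH
  have hEn : S.levelFun E n = S.levelFun F 0 + n := by
    rw [levelFun_congr hFE one_pos, ← hEt, zero_add]
  have hEtn : S.IsTight n E := fun i => by
    rw [← zero_add (n + i), hEt, ← add_assoc, ← hEt, zero_add]
  exact ⟨H ∘ E, S.comp_mem H hH.1 E hE.1, (hEn ▸ hHt).comp hH.1 hEtn, hFH⟩

theorem exists_tight_mem_MFix (hF : F ∈ S.MFix n) (m : ℕ) :
    ∃ E ∈ S.MFix n, S.IsTight m E ∧ restr (m + 1) F = restr (m + 1) E := by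
  rcases le_or_gt n (m + 1) with hnm | hmn
  · obtain ⟨E, hE, hEt, hFE⟩ := exists_tight hF.1 m
    exact ⟨E, mem_MFix_of_restr_eq hF hE (restr_eq_mono hFE hnm), hEt, hFE⟩
  · exact ⟨id, id_mem_MFix n, isTight_id m, restr_eq_mono (restr_eq_restr_id hF) hmn.le⟩

theorem exists_comp_comm (hF : F ∈ S.M) (hG : G ∈ S.MFix p) :
    ∃ G' ∈ S.MFix (S.levelFun F p), restr (p + 1) (F ∘ G) = restr (p + 1) (G' ∘ F) := by
  have hFG : F ∘ G ∈ S.M := S.comp_mem F hF G hG.1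
  have hlow : restr p (F ∘ G) = restr p F := restr_comp_left_congr F (restr_eq_restr_id hG)
  obtain ⟨G', hG', -, F', hF', hF'p, hcomp⟩ := exists_decomp hFG (n := p) (p := S.levelFun F p)
    (by rw [levelFun_comp hF]; exact (levelFun_strictMono hF).monotone (le_levelFun hG.1 p))
    fun i hi => by rw [levelFun_congr hlow hi]; exact levelFun_strictMono hF hi
  refine ⟨G', hG', hcomp.trans (restr_comp_left_congr G' ?_)⟩
  refine restr_succ_eq_iff.2 ⟨?_, fun b hb => ?_⟩
  · exact (restr_eq_of_restr_succ_eq_comp hF' hG' hF'p hcomp).symm.trans hlow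
  · -- Both values lie below `F (G b)` on the same level.
    have hF'b : F' b ≤ F (G b) := by
      rw [show F (G b) = G' (F' b) from restr_eq_iff.1 hcomp b (by omega)]
      exact le_apply_of_mem_MFix hG' (by rw [level_apply hF', hb, hF'p])
    have hFb : F b ≤ F (G b) :=
      (S.shape_preserving F hF).strictMono.monotone (le_apply_of_mem_MFix hG hb.le)
    exact S.eq_of_le_of_le_of_level_eq hF'b hFb
      (by rw [level_apply hF, level_apply hF', hb, hF'p])

end Factorization

section AMAt

variable {S : SMTree T A} {F G : T → T} {n k i j l p : ℕ} {f g : Below T (n + k) → T}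

theorem mem_AMAt_iff_exists_add_one_eq : f ∈ S.AMAt n k j ↔
    ∃ l, n + k = l + 1 ∧ ∃ F ∈ S.MFix n, S.levelFun F l = j ∧ restr (n + k) F = f := by
  constructor
  · rintro ⟨⟨F, hF, hfF⟩, a, ha, hj⟩
    exact ⟨level a.1, ha.symm, F, hF, by rw [← level_apply hF.1, ← hfF, hj], (funext hfF).symm⟩
  · rintro ⟨l, hl, F, hF, hj, rfl⟩
    obtain ⟨a, ha⟩ := S.exists_level_eq l
    refine ⟨⟨F, hF, fun _ => rfl⟩, ⟨a, by omega⟩, by rw [ha, hl], ?_⟩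
    rw [restr, level_apply hF.1, ha, hj]

theorem mem_AMAt_iff (h : n + k = l + 1) :
    f ∈ S.AMAt n k j ↔ ∃ F ∈ S.MFix n, S.levelFun F l = j ∧ restr (n + k) F = f := by
  rw [mem_AMAt_iff_exists_add_one_eq]
  constructor
  · rintro ⟨l', hl', hf⟩
    rwa [Nat.succ_injective (h.symm.trans hl')]
  · exact fun hf => ⟨l, h, hf⟩

theorem restr_mem_AMAt (hF : F ∈ S.MFix n) (h : n + k = l + 1) :
    restr (n + k) F ∈ S.AMAt n k (S.levelFun F l) :=
  (mem_AMAt_iff h).2 ⟨F, hF, rfl, rfl⟩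

theorem level_le_of_mem_AMAt (hf : f ∈ S.AMAt n k j) (a : Below T (n + k)) : level (f a) ≤ j := by
  obtain ⟨l, hl, F, hF, rfl, rfl⟩ := mem_AMAt_iff_exists_add_one_eq.1 hf
  rw [restr, level_apply hF.1]
  exact (levelFun_strictMono hF.1).monotone (Nat.le_of_lt_succ (a.2.trans_eq hl))

theorem le_of_mem_AMAt (hf : f ∈ S.AMAt n k j) : n + k ≤ j + 1 := by
  obtain ⟨l, hl, F, hF, rfl, rfl⟩ := mem_AMAt_iff_exists_add_one_eq.1 hf
  exact hl.trans_le (Nat.succ_le_succ (le_levelFun hF.1 l))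

theorem eq_of_mem_AMAt_of_mem_AMAt (hi : f ∈ S.AMAt n k i) (hj : f ∈ S.AMAt n k j) : i = j := by
  obtain ⟨l, hl, F, -, rfl, rfl⟩ := mem_AMAt_iff_exists_add_one_eq.1 hi
  obtain ⟨G, -, rfl, hFG⟩ := (mem_AMAt_iff hl).1 hj
  exact (levelFun_congr hFG (by omega)).symm

theorem comp_mem_AMAt (hF : F ∈ S.MFix n) (hf : f ∈ S.AMAt n k j) :
    F ∘ f ∈ S.AMAt n k (S.levelFun F j) := by
  obtain ⟨l, hl, G, hG, rfl, rfl⟩ := mem_AMAt_iff_exists_add_one_eq.1 hf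
  rw [← levelFun_comp hF.1]
  exact restr_mem_AMAt (comp_mem_MFix hF hG) hl

theorem comp_congr_of_mem_AMAt (hf : f ∈ S.AMAt n k j)
    (h : restr (j + 1) F = restr (j + 1) G) : F ∘ f = G ∘ f :=
  funext fun a => restr_eq_iff.1 h (f a) (Nat.lt_succ_of_le (level_le_of_mem_AMAt hf a))

/-- An element of `AM^n_k(j)` as a function into its bounded range `T(≤j)`. -/
def toBelow (hf : f ∈ S.AMAt n k j) (a : Below T (n + k)) : Below T (j + 1) :=
  ⟨f a, Nat.lt_succ_of_le (level_le_of_mem_AMAt hf a)⟩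

theorem finite_AMAt (S : SMTree T A) (n k j : ℕ) : Finite (S.AMAt n k j) := by
  have := S.finite_below (n + k)
  have := S.finite_below (j + 1)
  refine Finite.of_injective (fun f : S.AMAt n k j => toBelow f.2) fun f g hfg => ?_
  exact Subtype.ext (congrArg (Subtype.val ∘ ·) hfg)

theorem subsingleton_AMAt_zero (n j : ℕ) : (S.AMAt n 0 j).Subsingleton := by
  rintro f ⟨⟨F, hF, hfF⟩, -⟩ g ⟨⟨G, hG, hgG⟩, -⟩
  exact funext fun a => by rw [hfF, hgG, hF.2 a a.2, hG.2 a a.2]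

theorem subsingleton_AMAt_of_lt (hj : j < n + k) : (S.AMAt n k j).Subsingleton := by
  suffices h : ∀ f ∈ S.AMAt n k j, f = restr (n + k) id from
    fun f hf g hg => (h f hf).trans (h g hg).symm
  intro f hf
  obtain ⟨l, hl, F, hF, rfl, rfl⟩ := mem_AMAt_iff_exists_add_one_eq.1 hf
  have hFl : S.levelFun F l = l := le_antisymm (by omega) (le_levelFun hF.1 l)
  exact hl ▸ restr_eq_restr_id (mem_MFix_succ_of_levelFun_eq hF.1 hFl)

theorem exists_comp_eq_of_mem_AMAt {g : Below T (n + 1) → T} (hg : g ∈ S.AMAt n 1 j)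
    (hnp : n ≤ p) (hpj : p ≤ j) :
    ∃ G ∈ S.MFix p, S.levelFun G p = j ∧ ∃ f ∈ S.AMAt n 1 p, G ∘ f = g := by
  obtain ⟨F, hF, rfl, rfl⟩ := (mem_AMAt_iff rfl).1 hg
  obtain ⟨G, hG, -, F', hF', hF'n, hFG⟩ := exists_decomp hF.1 hpj
    fun i hi => (levelFun_of_mem_MFix hF hi).trans_lt (hi.trans_le hnp)
  have hF'fix : F' ∈ S.MFix n :=
    mem_MFix_of_restr_eq hF hF' (restr_eq_of_restr_succ_eq_comp hF' hG hF'n hFG)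
  refine ⟨G, hG, ?_, restr (n + 1) F', ?_, hFG.symm⟩
  · rw [levelFun_congr hFG n.lt_succ_self, levelFun_comp hG.1, hF'n]
  · exact hF'n ▸ restr_mem_AMAt hF'fix rfl

/-- The restriction to `T(≤n)` of a partial function defined on `T(≤n+k+1)`. -/
def trunc (f : Below T (n + (k + 2)) → T) : Below T (n + 1) → T :=
  f ∘ Below.castLE (by omega)

theorem exists_trunc_mem_AMAt {f : Below T (n + (k + 2)) → T} (hf : f ∈ S.AMAt n (k + 2) j) :
    ∃ i < j, trunc f ∈ S.AMAt n 1 i := by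
  obtain ⟨F, hF, rfl, rfl⟩ := (mem_AMAt_iff (add_assoc n (k + 1) 1).symm).1 hf
  exact ⟨_, levelFun_strictMono hF.1 (by omega), restr_mem_AMAt hF rfl⟩

theorem exists_factor_of_mem_AMAt (k : ℕ) {x : Below T (n + 1) → T} (hx : x ∈ S.AMAt n 1 i) :
    ∃ E : Below T (n + (k + 2)) → Below T (i + 1 + (k + 1)), ∀ j, ∀ f ∈ S.AMAt n (k + 2) j,
      trunc f = x → ∃ h ∈ S.AMAt (i + 1) (k + 1) j, h ∘ E = f := by
  obtain ⟨X, hX, rfl, rfl⟩ := (mem_AMAt_iff rfl).1 hx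
  obtain ⟨E, hE, hEt, hXE⟩ := exists_tight hX.1 n
  have hEtop : S.levelFun E (n + (k + 1)) = S.levelFun X n + 1 + k := by
    rw [hEt, ← levelFun_congr hXE n.lt_succ_self]
    omega
  refine ⟨fun a => ⟨E a, ?_⟩, ?_⟩
  · rw [level_apply hE]
    have := (levelFun_strictMono hE).monotone (show level a.1 ≤ n + (k + 1) by omega)
    omega
  rintro j f hf hfX
  obtain ⟨F, hF, rfl, rfl⟩ := (mem_AMAt_iff (add_assoc n (k + 1) 1).symm).1 hf
  have hFX : restr (n + 1) F = restr (n + 1) X := hfX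
  obtain ⟨H, hH, -, hFH⟩ := exists_factor hF.1 hE (hFX.trans hXE) hEt (k + 1)
  rw [levelFun_congr hFX n.lt_succ_self] at hH
  refine ⟨restr _ H, (mem_AMAt_iff (add_assoc _ k 1).symm).2 ⟨H, hH, ?_, rfl⟩, hFH.symm⟩
  rw [← hEtop, levelFun_congr hFH (Nat.lt_succ_self _), levelFun_comp hH.1]

end AMAt

section IsRamsey

/-- The one-colour statement for `AM^n_k(M)`, with the copying function taken in `M^n` and with
colours given to all partial functions `T(<n+k) → T`. -/
def IsRamsey (S : SMTree T A) (n k M : ℕ) : Prop :=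
  ∀ r, ∃ N, ∀ χ : (Below T (n + k) → T) → Fin r, ∃ F ∈ S.MFix n, S.levelFun F M = N ∧
    ∃ c, ∀ g ∈ S.AMAt n k M, χ (F ∘ g) = c

variable {S : SMTree T A} {n k l M : ℕ}

theorem IsRamsey.of_subsingleton (h : (S.AMAt n k M).Subsingleton) : S.IsRamsey n k M := by
  refine fun r => ⟨M, fun χ => ⟨id, id_mem_MFix n, levelFun_id M, ?_⟩⟩
  rcases h.eq_empty_or_singleton with h | ⟨f, h⟩
  · exact ⟨χ (restr _ id), by simp only [h, Set.mem_empty_iff_false, false_imp_iff, implies_true]⟩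
  · exact ⟨χ f, by simp only [h, Set.mem_singleton_iff, forall_eq, Function.id_comp]⟩

theorem IsRamsey.exists_monochromatic (h : S.IsRamsey n k M) (κ : Type*) [Finite κ] :
    ∃ N, ∀ χ : (Below T (n + k) → T) → κ, ∃ F ∈ S.MFix n, S.IsTight M F ∧ S.levelFun F M = N ∧
      ∃ c, ∀ g ∈ S.AMAt n k M, χ (F ∘ g) = c := by
  obtain ⟨N, hN⟩ := h (Nat.card κ)
  refine ⟨N, fun χ => ?_⟩
  obtain ⟨F, hF, hFM, c, hc⟩ := hN (Finite.equivFin κ ∘ χ)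
  obtain ⟨E, hE, hEt, hFE⟩ := exists_tight_mem_MFix hF M
  refine ⟨E, hE, hEt, by rw [← levelFun_congr hFE M.lt_succ_self, hFM],
    (Finite.equivFin κ).symm c, fun g hg => ?_⟩
  rw [Equiv.eq_symm_apply, ← comp_congr_of_mem_AMAt hg hFE]
  exact hc g hg

theorem IsRamsey.exists_family (h : S.IsRamsey n k M) {ι κ : Type*} [Finite ι] [Finite κ]
    (E : ι → Below T l → Below T (n + k)) :
    ∃ N, ∀ χ : (Below T l → T) → κ, ∃ H ∈ S.MFix n, S.levelFun H M = N ∧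
      ∃ φ : ι → κ, ∀ x, ∀ h ∈ S.AMAt n k M, χ (H ∘ h ∘ E x) = φ x := by
  obtain ⟨N, hN⟩ := h.exists_monochromatic (ι → κ)
  refine ⟨N, fun χ => ?_⟩
  obtain ⟨H, hH, -, hHM, φ, hφ⟩ := hN fun h x => χ (h ∘ E x)
  exact ⟨H, hH, hHM, φ, fun x h hh => congrFun (hφ h hh) x⟩

end IsRamsey

section Letters

/-- For `a` of level `n` whose extension `e a` is given by the successor operation with some
parameter and character, the same parameter and character are used at level `v` below `F a`. -/
def HasLetter (S : SMTree T A) (n : ℕ) (e : T → T) (v : ℕ) (F : T → T) : Prop :=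
  ∀ a p c, level a = n → S.succ a p c = some (e a) →
    ∃ b t, level b = v ∧ S.succ b p c = some t ∧ t ≤ F a

/-- On level `n`, each value of `F'` is the immediate successor of the value of `F` with the
parameter and character that lead from `a` to `e a`. -/
def Appends (S : SMTree T A) (n : ℕ) (e F F' : T → T) : Prop :=
  ∀ a p c, level a = n → S.succ a p c = some (e a) → S.succ (F a) p c = some (F' a)

/-- A function in `M` that skips only level `m` and repeats there the successors used on level `v`;
the identity if `v < m` fails. -/
noncomputable def dup (S : SMTree T A) (v m : ℕ) : T → T :=
  if h : v < m then (S.duplication v m h).choose else id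

variable {S : SMTree T A} {n v m : ℕ} {e F F' G G' : T → T}

theorem dup_spec (h : v < m) : S.dup v m ∈ S.M ∧ SkipsOnly (S.dup v m) m ∧
    ∀ a b : T, level a = v → level b = m → ∀ p c s, S.succ a p c = some s → s ≤ b →
      S.succ b p c = some (S.dup v m b) := by
  rw [dup, dif_pos h]
  exact (S.duplication v m h).choose_spec

theorem levelFun_dup_add (h : v < m) (i : ℕ) : S.levelFun (S.dup v m) (m + i) = m + i + 1 := by
  rw [levelFun_eq_of_skipsOnly (dup_spec h).1 (dup_spec h).2.1, if_neg (by omega)]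

theorem dup_mem_MFix (h : v < m) : S.dup v m ∈ S.MFix m := by
  refine (mem_MFix_iff_levelFun (dup_spec h).1).2 fun i hi => ?_
  rw [levelFun_eq_of_skipsOnly (dup_spec h).1 (dup_spec h).2.1, if_pos hi]

theorem exists_succ_eq_some_apply (he : e ∈ S.MFix n) (hen : S.levelFun e n = n + 1) {a : T}
    (ha : level a = n) : ∃ p c, S.succ a p c = some (e a) := by
  have hea : level (e a) = level a + 1 := by rw [level_apply he.1, ha, hen]
  obtain ⟨a', p, c, hs⟩ := S.exists_succ_eq (b := e a) (by omega)
  have ha' := S.level_of_succ hs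
  obtain rfl : a = a' := S.eq_of_le_of_le_of_level_eq (le_apply_of_mem_MFix he ha.le)
    (S.covBy_of_succ _ _ _ _ hs).le (by omega)
  exact ⟨p, c, hs⟩

theorem Appends.apply_le (h : S.Appends n e F F') (he : e ∈ S.MFix n)
    (hen : S.levelFun e n = n + 1) {a : T} (ha : level a = n) : F a ≤ F' a := by
  obtain ⟨p, c, hs⟩ := exists_succ_eq_some_apply he hen ha
  exact (S.covBy_of_succ _ _ _ _ (h a p c ha hs)).le

theorem Appends.restr_eq (hF : S.Appends n e F F') (hG : S.Appends n e G G') (he : e ∈ S.MFix n)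
    (hen : S.levelFun e n = n + 1) (hF' : F' ∈ S.MFix n) (hG' : G' ∈ S.MFix n)
    (hFG : restr (n + 1) F = restr (n + 1) G) : restr (n + 1) F' = restr (n + 1) G' := by
  refine restr_succ_eq_iff.2
    ⟨(restr_eq_restr_id hF').trans (restr_eq_restr_id hG').symm, fun a ha => ?_⟩
  obtain ⟨p, c, hs⟩ := exists_succ_eq_some_apply he hen ha
  have hF'a := hF a p c ha hs
  rw [restr_eq_iff.1 hFG a (by omega), hG a p c ha hs] at hF'a
  exact (Option.some.inj hF'a).symm

theorem Appends.hasLetter (h : S.Appends n e F F') (hF : F ∈ S.M) :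
    S.HasLetter n e (S.levelFun F n) F' :=
  fun a p c ha hs => ⟨F a, F' a, by rw [level_apply hF, ha], h a p c ha hs, le_rfl⟩

theorem HasLetter.mono (h : S.HasLetter n e v F) (hF : ∀ a, level a = n → F a ≤ F' a) :
    S.HasLetter n e v F' := fun a p c ha hs =>
  let ⟨b, t, hb, ht, hle⟩ := h a p c ha hs
  ⟨b, t, hb, ht, hle.trans (hF a ha)⟩

theorem HasLetter.dup_comp {w : ℕ} (h : S.HasLetter n e w F) (hF : F ∈ S.M) (hvm : v < m)
    (hFm : S.levelFun F n = m) : S.HasLetter n e w (S.dup v m ∘ F) :=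
  h.mono fun a ha => le_apply_of_mem_MFix (dup_mem_MFix hvm) (by rw [level_apply hF, ha, hFm])

theorem HasLetter.appends_dup_comp (h : S.HasLetter n e v F) (hF : F ∈ S.M) (hvm : v < m)
    (hFm : S.levelFun F n = m) : S.Appends n e F (S.dup v m ∘ F) := fun a p c ha hs =>
  let ⟨b, t, hb, ht, hle⟩ := h a p c ha hs
  (dup_spec hvm).2.2 b (F a) hb (by rw [level_apply hF, ha, hFm]) p c t ht hle

theorem appends_comp (he : e ∈ S.MFix n) (hen : S.levelFun e n = n + 1) (hF : F ∈ S.MFix n)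
    (hFn : S.levelFun F (n + 1) = S.levelFun F n + 1) : S.Appends n e F (F ∘ e) := by
  intro a p c ha hs
  have hmap := (S.shape_preserving F hF.1).succ_map hs
    (by rw [level_apply hF.1, level_apply hF.1, level_apply he.1, ha, hen, hFn])
  rwa [STree.map_param_congr hs (ha ▸ restr_eq_restr_id hF), List.map_id] at hmap

end Letters

section Alphabet

/-- Letters `e x` moving level `n` to level `n + 1`, with a base function below whose values every
letter occurs, `e x` on level `pos x`. -/
structure Alphabet (S : SMTree T A) (n : ℕ) (α : Type*) where
  /-- the functions serving as letters -/
  letter : α → T → T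
  /-- the function representing the empty word -/
  base : T → T
  /-- the levels on which the letters occur below the base -/
  pos : α → ℕ
  letter_mem : ∀ x, letter x ∈ S.MFix n
  levelFun_letter : ∀ x, S.levelFun (letter x) n = n + 1
  base_mem : base ∈ S.MFix n
  base_tight : S.IsTight n base
  pos_lt : ∀ x, pos x < S.levelFun base n
  hasLetter : ∀ x, S.HasLetter n (letter x) (pos x) base

variable {S : SMTree T A} {n v : ℕ} {α : Type*}

theorem exists_base [Finite α] {e : α → T → T} (he : ∀ x, e x ∈ S.MFix n)
    (hen : ∀ x, S.levelFun (e x) n = n + 1) :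
    ∃ B ∈ S.MFix n, S.IsTight n B ∧ ∀ x, ∃ v < S.levelFun B n, S.HasLetter n (e x) v B := by
  classical
  have := Fintype.ofFinite α
  suffices h : ∀ s : Finset α, ∃ B ∈ S.MFix n, S.IsTight n B ∧
      ∀ x ∈ s, ∃ v < S.levelFun B n, S.HasLetter n (e x) v B by simpa using h Finset.univ
  intro s
  induction s using Finset.induction with
  | empty => exact ⟨id, id_mem_MFix n, isTight_id n, by simp⟩
  | insert y s _ ih =>
    obtain ⟨B, hB, hBt, hBs⟩ := ih
    obtain ⟨B', hB', hB't, hBB'⟩ := exists_tight_mem_MFix (comp_mem_MFix hB (he y)) n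
    have hB'n : S.levelFun B' n = S.levelFun B n + 1 := by
      rw [← levelFun_congr hBB' n.lt_succ_self, levelFun_comp hB.1, hen, hBt 1]
    have happ : S.Appends n (e y) B B' := fun a p c ha hs => by
      rw [← restr_eq_iff.1 hBB' a (by omega)]
      exact appends_comp (he y) (hen y) hB (hBt 1) a p c ha hs
    refine ⟨B', hB', hB't, fun x hx => ?_⟩
    rcases Finset.mem_insert.1 hx with rfl | hx
    · exact ⟨S.levelFun B n, by omega, happ.hasLetter hB.1⟩
    · obtain ⟨v, hv, hvB⟩ := hBs x hx
      exact ⟨v, by omega, hvB.mono fun a ha => happ.apply_le (he y) (hen y) ha⟩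

theorem exists_alphabet [Finite α] {e : α → T → T} (he : ∀ x, e x ∈ S.MFix n)
    (hen : ∀ x, S.levelFun (e x) n = n + 1) : ∃ L : S.Alphabet n α, L.letter = e := by
  obtain ⟨B, hB, hBt, h⟩ := exists_base he hen
  choose pos hpos hlet using h
  exact ⟨⟨e, B, pos, he, hen, hB, hBt, hpos, hlet⟩, rfl⟩

namespace Alphabet

/-- The level to which functions representing words of length `l` map level `n`. -/
noncomputable def height (L : S.Alphabet n α) (l : ℕ) : ℕ := S.levelFun L.base n + l

/-- The function representing a word, read from right to left: each letter is appended on top by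
duplicating the level on which it occurs below the base. -/
noncomputable def word (L : S.Alphabet n α) : List α → T → T
  | [] => L.base
  | x :: w => S.dup (L.pos x) (L.height w.length) ∘ L.word w

variable (L : S.Alphabet n α)

theorem le_height (l : ℕ) : n ≤ L.height l :=
  (le_levelFun L.base_mem.1 n).trans (Nat.le_add_right _ l)

theorem pos_lt_height (x : α) (l : ℕ) : L.pos x < L.height l :=
  (L.pos_lt x).trans_le (Nat.le_add_right _ l)

theorem dup_mem_MFix_of_lt_height {l : ℕ} (hv : v < L.height l) :
    S.dup v (L.height l) ∈ S.MFix n :=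
  MFix_anti (L.le_height l) (dup_mem_MFix hv)

theorem word_mem (w : List α) : L.word w ∈ S.MFix n := by
  induction w with
  | nil => exact L.base_mem
  | cons x w ih =>
    exact comp_mem_MFix (L.dup_mem_MFix_of_lt_height (L.pos_lt_height x _)) ih

theorem levelFun_word_add (w : List α) (i : ℕ) :
    S.levelFun (L.word w) (n + i) = L.height w.length + i := by
  induction w with
  | nil => exact L.base_tight i
  | cons x w ih =>
    have hx := L.pos_lt_height x w.length
    rw [word, levelFun_comp (dup_mem_MFix hx).1, ih, levelFun_dup_add hx, List.length_cons,
      height, height]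
    omega

theorem levelFun_word (w : List α) : S.levelFun (L.word w) n = L.height w.length :=
  L.levelFun_word_add w 0

theorem word_hasLetter (w : List α) (y : α) : S.HasLetter n (L.letter y) (L.pos y) (L.word w) := by
  induction w with
  | nil => exact L.hasLetter y
  | cons x w ih =>
    exact ih.dup_comp (L.word_mem w).1 (L.pos_lt_height x _) (L.levelFun_word w)

theorem word_appends (w : List α) (y : α) :
    S.Appends n (L.letter y) (L.word w) (L.word (y :: w)) :=
  (L.word_hasLetter w y).appends_dup_comp (L.word_mem w).1 (L.pos_lt_height y _) (L.levelFun_word w)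

/-- `F` represents the variable word `w`, with `none` as the variable: composing `F` with the letter
`x` amounts to substituting `x` in `w`. The letter so substituted can be found on level `v`. -/
structure Realizes (w : List (Option α)) (F : T → T) (v : ℕ) : Prop where
  mem : F ∈ S.MFix n
  levelFun_eq : S.levelFun F (n + 1) = L.height w.length
  restr_comp_letter : ∀ x,
    restr (n + 1) (F ∘ L.letter x) = restr (n + 1) (L.word (w.map fun y => y.getD x))
  var_lt : v < L.height w.length
  hasLetter : ∀ x, S.HasLetter n (L.letter x) v (F ∘ L.letter x)

variable {L}

theorem realizes_none_cons (u : List α) :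
    L.Realizes (none :: u.map some) (L.word u) (L.height u.length) := by
  have happ : ∀ x, S.Appends n (L.letter x) (L.word u) (L.word u ∘ L.letter x) := fun x =>
    appends_comp (L.letter_mem x) (L.levelFun_letter x) (L.word_mem u)
      (by rw [L.levelFun_word_add, L.levelFun_word])
  refine ⟨L.word_mem u, ?_, fun x => ?_, ?_, fun x => ?_⟩
  · rw [L.levelFun_word_add, List.length_cons, List.length_map, height, height, add_assoc]
  · have hmap : (none :: u.map some).map (fun y => y.getD x) = x :: u := by simp
    rw [hmap]
    exact (happ x).restr_eq (L.word_appends u x) (L.letter_mem x) (L.levelFun_letter x)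
      (comp_mem_MFix (L.word_mem u) (L.letter_mem x)) (L.word_mem _) rfl
  · rw [List.length_cons, List.length_map, height, height]
    omega
  · rw [← L.levelFun_word]
    exact (happ x).hasLetter (L.word_mem u).1

theorem Realizes.cons {w : List (Option α)} {F : T → T} (h : L.Realizes w F v) (y : Option α) :
    L.Realizes (y :: w) (S.dup (y.elim v L.pos) (L.height w.length) ∘ F) v := by
  have hy : y.elim v L.pos < L.height w.length := by
    cases y with
    | none => exact h.var_lt
    | some y => exact L.pos_lt_height y _
  have hFx : ∀ x, F ∘ L.letter x ∈ S.MFix n := fun x => comp_mem_MFix h.mem (L.letter_mem x)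
  have hlev : ∀ x, S.levelFun (F ∘ L.letter x) n = L.height w.length := fun x => by
    rw [levelFun_comp h.mem.1, L.levelFun_letter, h.levelFun_eq]
  have hlet : ∀ x, S.HasLetter n (L.letter (y.getD x)) (y.elim v L.pos) (F ∘ L.letter x) := by
    intro x
    cases y with
    | none => exact h.hasLetter x
    | some y =>
      exact (L.word_hasLetter _ y).mono fun a ha =>
        (restr_eq_iff.1 (h.restr_comp_letter x) a (by omega)).ge
  have hdup := L.dup_mem_MFix_of_lt_height hy
  refine ⟨comp_mem_MFix hdup h.mem, ?_, fun x => ?_, ?_, fun x => ?_⟩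
  · rw [levelFun_comp hdup.1, h.levelFun_eq]
    exact levelFun_dup_add hy 0
  · exact ((hlet x).appends_dup_comp (hFx x).1 hy (hlev x)).restr_eq (L.word_appends _ (y.getD x))
      (L.letter_mem _) (L.levelFun_letter _) (comp_mem_MFix hdup (hFx x)) (L.word_mem _)
      (h.restr_comp_letter x)
  · exact h.var_lt.trans (Nat.lt_succ_self _)
  · exact (h.hasLetter x).dup_comp (hFx x).1 hy (hlev x)

theorem exists_realizes (L : S.Alphabet n α) {w : List (Option α)} (hw : none ∈ w) :
    ∃ F v, L.Realizes w F v := by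
  induction w with
  | nil => exact absurd hw List.not_mem_nil
  | cons y w ih =>
    by_cases hw' : none ∈ w
    · obtain ⟨F, v, h⟩ := ih hw'
      exact ⟨_, v, h.cons y⟩
    · obtain rfl : none = y := (List.mem_cons.1 hw).resolve_right hw'
      obtain ⟨u, rfl⟩ : w ∈ Set.range (List.map some) := by
        rw [Set.range_list_map]
        exact fun y hy => Option.ne_none_iff_exists.1 fun h => hw' (h ▸ hy)
      exact ⟨_, _, realizes_none_cons u⟩

end Alphabet

end Alphabet

section Pigeonhole

variable {S : SMTree T A} {n : ℕ} {D : T → T}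

theorem isRamsey_one_succ (S : SMTree T A) (n : ℕ) : S.IsRamsey n 1 (n + 1) := by
  intro r
  have := S.finite_AMAt n 1 (n + 1)
  choose e he hen hrestr using fun x : S.AMAt n 1 (n + 1) => (mem_AMAt_iff rfl).1 x.2
  obtain ⟨L, rfl⟩ := exists_alphabet he hen
  obtain ⟨ι, _, hι⟩ := Combinatorics.Line.exists_mono_in_high_dimension (S.AMAt n 1 (n + 1)) (Fin r)
  refine ⟨L.height (Finset.univ : Finset ι).toList.length, fun χ => ?_⟩
  obtain ⟨l, c, hl⟩ := hι fun w => χ (restr (n + 1) (L.word (Finset.univ.toList.map w)))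
  obtain ⟨i, hi⟩ := l.proper
  obtain ⟨F, v, hF⟩ := L.exists_realizes (w := Finset.univ.toList.map l.idxFun)
    (List.mem_map.2 ⟨i, Finset.mem_toList.2 (Finset.mem_univ i), hi⟩)
  refine ⟨F, hF.mem, by rw [hF.levelFun_eq, List.length_map], c, fun g hg => ?_⟩
  have hFg : F ∘ g = restr (n + 1) (L.word (Finset.univ.toList.map (l ⟨g, hg⟩))) :=
    calc F ∘ g = F ∘ restr (n + 1) (L.letter ⟨g, hg⟩) := by rw [hrestr]
      _ = restr (n + 1) (L.word ((Finset.univ.toList.map l.idxFun).map (·.getD ⟨g, hg⟩))) :=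
        hF.restr_comp_letter ⟨g, hg⟩
      _ = _ := by rw [List.map_map]; rfl
  rw [hFg]
  exact hl ⟨g, hg⟩

theorem isRamsey_one_add (S : SMTree T A) (n m : ℕ) : S.IsRamsey n 1 (n + m) := by
  induction m generalizing n with
  | zero => exact .of_subsingleton (subsingleton_AMAt_of_lt n.lt_succ_self)
  | succ m ih =>
    intro r
    obtain ⟨N₀, hN₀⟩ := (S.isRamsey_one_succ n).exists_monochromatic (Fin r)
    have := S.finite_AMAt n 1 N₀
    obtain ⟨N, hN⟩ := (ih N₀).exists_family (κ := Fin r) fun x : S.AMAt n 1 N₀ => toBelow x.2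
    refine ⟨N, fun χ => ?_⟩
    obtain ⟨H, hH, hHN, φ, hφ⟩ := hN χ
    obtain ⟨F, hF, hFt, hFN, c, hc⟩ := hN₀ (Function.extend Subtype.val φ χ)
    have hnN₀ : n ≤ N₀ := by have := le_levelFun hF.1 (n + 1); omega
    have hFm : S.levelFun F (n + (m + 1)) = N₀ + m := by rw [add_comm m, ← add_assoc, hFt, hFN]
    refine ⟨H ∘ F, comp_mem_MFix (MFix_anti hnN₀ hH) hF, by rw [levelFun_comp hH.1, hFm, hHN], c,
      fun g hg => ?_⟩
    obtain ⟨G, hG, hGn, f, hf, rfl⟩ := exists_comp_eq_of_mem_AMAt hg n.le_succ (by omega)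
    obtain ⟨G', hG', hcomm⟩ := exists_comp_comm hF.1 hG
    rw [hFN] at hG'
    have hG'N₀ : S.levelFun G' N₀ = N₀ + m := by
      rw [← hFN, ← levelFun_comp hG'.1, ← levelFun_congr hcomm (Nat.lt_succ_self _),
        levelFun_comp hF.1, hGn, hFm, hFN]
    have hFf : F ∘ f ∈ S.AMAt n 1 N₀ := hFN ▸ comp_mem_AMAt hF hf
    calc χ ((H ∘ F) ∘ (G ∘ f)) = χ (H ∘ restr (N₀ + 1) G' ∘ toBelow hFf) :=
          congrArg (χ <| H ∘ ·) (comp_congr_of_mem_AMAt hf hcomm)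
      _ = φ ⟨F ∘ f, hFf⟩ := hφ ⟨F ∘ f, hFf⟩ _ (hG'N₀ ▸ restr_mem_AMAt hG' rfl)
      _ = Function.extend Subtype.val φ χ (F ∘ f) :=
          (Subtype.val_injective.extend_apply φ χ ⟨F ∘ f, hFf⟩).symm
      _ = c := hc f hf

theorem isRamsey_one (S : SMTree T A) (n M : ℕ) : S.IsRamsey n 1 M := by
  rcases lt_or_ge M n with h | h
  · exact .of_subsingleton (subsingleton_AMAt_of_lt (h.trans n.lt_succ_self))
  · exact Nat.add_sub_cancel' h ▸ S.isRamsey_one_add n (M - n)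

theorem exists_mono_each_level (S : SMTree T A) (n M : ℕ) (κ : Type*) [Finite κ] :
    ∃ N, ∀ χ : (Below T (n + 1) → T) → κ, ∃ F ∈ S.MFix n, S.levelFun F M = N ∧
      ∃ c : ℕ → κ, ∀ i ≤ M, ∀ g ∈ S.AMAt n 1 i, χ (F ∘ g) = c i := by
  induction M with
  | zero =>
    obtain ⟨N, hN⟩ := (S.isRamsey_one n 0).exists_monochromatic κ
    refine ⟨N, fun χ => ?_⟩
    obtain ⟨F, hF, -, hF0, c, hc⟩ := hN χ
    exact ⟨F, hF, hF0, fun _ => c, fun i hi g hg => hc g (Nat.le_zero.1 hi ▸ hg)⟩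
  | succ M ih =>
    obtain ⟨N₁, hN₁⟩ := ih
    obtain ⟨N, hN⟩ := (S.isRamsey_one n (N₁ + 1)).exists_monochromatic κ
    refine ⟨N, fun χ => ?_⟩
    obtain ⟨H, hH, -, hHN, c, hc⟩ := hN χ
    obtain ⟨F, hF, hFM, d, hd⟩ := hN₁ fun f => χ (H ∘ f)
    obtain ⟨E, hE, hEt, hFE⟩ := exists_tight_mem_MFix hF M
    have hEM : S.levelFun E (M + 1) = N₁ + 1 := by
      rw [hEt 1, ← levelFun_congr hFE M.lt_succ_self, hFM]
    refine ⟨H ∘ E, comp_mem_MFix hH hE, by rw [levelFun_comp hH.1, hEM, hHN],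
      Function.update d (M + 1) c, fun i hi g hg => ?_⟩
    rcases hi.lt_or_eq with hi | rfl
    · rw [Function.update_of_ne hi.ne, ← hd i (Nat.le_of_lt_succ hi) g hg, Function.comp_assoc,
        comp_congr_of_mem_AMAt hg (restr_eq_mono hFE hi)]
    · rw [Function.update_self]
      exact hc (E ∘ g) (hEM ▸ comp_mem_AMAt hE hg)

theorem exists_tight_levelFun_eq_add_one (hD : D ∈ S.MFix n) (hDn : S.levelFun D n ≠ n) {j : ℕ}
    (hj : n ≤ j) : ∃ F ∈ S.MFix j, S.IsTight j F ∧ S.levelFun F j = j + 1 := by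
  rcases hj.eq_or_lt with rfl | hj
  · obtain ⟨G, hG, -, F, hF, hFn, hDG⟩ := exists_decomp hD.1 (n := n) (p := n + 1)
      ((le_levelFun hD.1 n).lt_of_ne' hDn) fun i hi => by rw [levelFun_of_mem_MFix hD hi]; omega
    have hFfix : F ∈ S.MFix n :=
      mem_MFix_of_restr_eq hD hF (restr_eq_of_restr_succ_eq_comp hF hG hFn hDG)
    obtain ⟨E, hE, hEt, hFE⟩ := exists_tight_mem_MFix hFfix n
    exact ⟨E, hE, hEt, by rw [← levelFun_congr hFE n.lt_succ_self, hFn]⟩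
  · have hj0 : 0 < j := by omega
    refine ⟨S.dup 0 j, dup_mem_MFix hj0, fun i => ?_, levelFun_dup_add hj0 0⟩
    rw [levelFun_dup_add hj0, show S.levelFun (S.dup 0 j) j = j + 1 from levelFun_dup_add hj0 0]
    omega

theorem exists_levelFun_eq (hD : D ∈ S.MFix n) (hDn : S.levelFun D n ≠ n) {j p : ℕ}
    (hj : n ≤ j) (hp : j ≤ p) : ∃ F ∈ S.MFix j, S.levelFun F j = p := by
  obtain ⟨F, hF, hFt, hFj⟩ := exists_tight_levelFun_eq_add_one hD hDn hj
  induction p, hp using Nat.le_induction with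
  | base => exact ⟨id, id_mem_MFix j, levelFun_id j⟩
  | succ p hp ih =>
    obtain ⟨G, hG, hGj⟩ := ih
    refine ⟨F ∘ G, comp_mem_MFix hF hG, ?_⟩
    rw [levelFun_comp hF.1, hGj, ← Nat.add_sub_cancel' hp, hFt, hFj]
    omega

theorem exists_levelFun_add_eq (hD : D ∈ S.MFix n) (hDn : S.levelFun D n ≠ n) {φ : ℕ → ℕ}
    (hφ : StrictMono φ) (hnφ : n ≤ φ 0) (t : ℕ) :
    ∃ F ∈ S.MFix n, ∀ i ≤ t, S.levelFun F (n + i) = φ i := by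
  induction t with
  | zero =>
    obtain ⟨F, hF, hFn⟩ := exists_levelFun_eq hD hDn le_rfl hnφ
    exact ⟨F, hF, fun i hi => by rw [Nat.le_zero.1 hi, add_zero, hFn]⟩
  | succ t ih =>
    obtain ⟨F, hF, hFφ⟩ := ih
    obtain ⟨E, hE, hEt, hFE⟩ := exists_tight_mem_MFix hF (n + t)
    have hEφ : ∀ i ≤ t, S.levelFun E (n + i) = φ i := fun i hi => by
      rw [← levelFun_congr hFE (by omega), hFφ i hi]
    have hnt : n ≤ φ t := hnφ.trans (hφ.monotone t.zero_le)
    obtain ⟨G, hG, hGt⟩ := exists_levelFun_eq hD hDn (hnt.trans (Nat.le_succ _))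
      (hφ t.lt_succ_self)
    refine ⟨G ∘ E, comp_mem_MFix (MFix_anti (by omega) hG) hE, fun i hi => ?_⟩
    rw [levelFun_comp hG.1]
    rcases hi.lt_or_eq with hi | rfl
    · have hit := Nat.le_of_lt_succ hi
      rw [hEφ i hit, levelFun_of_mem_MFix hG (Nat.lt_succ_of_le (hφ.monotone hit))]
    · rw [← add_assoc, hEt 1, hEφ t le_rfl, hGt]

theorem exists_levelFun_mem (hD : D ∈ S.MFix n) (hDn : S.levelFun D n ≠ n) {p t : ℕ}
    {J : Finset ℕ} (hJ : J ⊆ Finset.Ico n p) (hnp : n ≤ p) (ht : t ≤ J.card) :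
    ∃ F ∈ S.MFix n, S.levelFun F (n + t) = p ∧ ∀ i < t, S.levelFun F (n + i) ∈ J := by
  obtain ⟨K, hKJ, rfl⟩ := Finset.exists_subset_card_eq ht
  let q : ℕ → Prop := fun j => j ∈ K ∨ p ≤ j
  have hKn : ∀ j ∈ K, n ≤ j ∧ j < p := fun j hj => Finset.mem_Ico.1 (hJ (hKJ hj))
  have hq : {j | q j}.Infinite := (Set.Ici_infinite p).mono fun j hj => Or.inr hj
  have hmem : ∀ i, Nat.nth q i ∈ K ∨ p ≤ Nat.nth q i := Nat.nth_mem_of_infinite hq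
  have hcard : Nat.nth q K.card = p := by
    classical
    have hcount : Nat.count q p = K.card := by
      rw [Nat.count_eq_card_filter_range]
      congr 1
      ext j
      grind
    rw [← hcount]
    exact Nat.nth_count (Or.inr le_rfl)
  obtain ⟨F, hF, hFq⟩ := exists_levelFun_add_eq hD hDn (Nat.nth_strictMono hq)
    ((hmem 0).elim (fun h => (hKn _ h).1) hnp.trans) K.card
  refine ⟨F, hF, by rw [hFq _ le_rfl, hcard], fun i hi => ?_⟩
  have hip : Nat.nth q i < p := hcard ▸ Nat.nth_strictMono hq hi
  rw [hFq i hi.le]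
  exact hKJ ((hmem i).resolve_right hip.not_ge)

theorem exists_mono_lt (S : SMTree T A) (n m : ℕ) (κ : Type*) [Finite κ] :
    ∃ N, ∀ χ : (Below T (n + 1) → T) → κ, ∃ F ∈ S.MFix n, S.levelFun F m = N ∧
      ∃ c, ∀ i < m, ∀ g ∈ S.AMAt n 1 i, χ (F ∘ g) = c := by
  by_cases hfix : ∀ D ∈ S.MFix n, S.levelFun D n < m → S.levelFun D n = n
  · refine ⟨m, fun χ => ⟨id, id_mem_MFix n, levelFun_id m, χ (restr (n + 1) id), ?_⟩⟩
    intro i hi g hg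
    obtain ⟨D, hD, rfl, rfl⟩ := (mem_AMAt_iff rfl).1 hg
    rw [restr_eq_restr_id (mem_MFix_succ_of_levelFun_eq hD.1 (hfix D hD hi)), Function.id_comp]
  push Not at hfix
  obtain ⟨D, hD, hDm, hDn⟩ := hfix
  obtain ⟨t, rfl⟩ := Nat.exists_eq_add_of_le ((le_levelFun hD.1 n).trans hDm.le)
  have := Fintype.ofFinite κ
  classical
  obtain ⟨N, hN⟩ := S.exists_mono_each_level n (n + Fintype.card κ * t) κ
  refine ⟨N, fun χ => ?_⟩
  have : Nonempty κ := ⟨χ (restr (n + 1) id)⟩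
  obtain ⟨F, hF, hFN, d, hd⟩ := hN χ
  obtain ⟨c, -, hc⟩ := Finset.exists_le_card_fiber_of_mul_le_card_of_maps_to
    (s := Finset.Ico n (n + Fintype.card κ * t)) (t := Finset.univ) (f := d) (n := t)
    (fun _ _ => Finset.mem_univ _) Finset.univ_nonempty (by simp)
  obtain ⟨G, hG, hGt, hGc⟩ :=
    exists_levelFun_mem hD hDn (Finset.filter_subset _ _) (Nat.le_add_right _ _) hc
  refine ⟨F ∘ G, comp_mem_MFix hF hG, by rw [levelFun_comp hF.1, hGt, hFN], c, fun i hi g hg => ?_⟩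
  obtain ⟨i, rfl⟩ := Nat.exists_eq_add_of_le (Nat.le_of_succ_le_succ (le_of_mem_AMAt hg))
  obtain ⟨hGi, hdc⟩ := Finset.mem_filter.1 (hGc i (by omega))
  rw [← hdc]
  exact hd _ (Finset.mem_Ico.1 hGi).2.le (G ∘ g) (comp_mem_AMAt hG hg)

end Pigeonhole

section Ramsey

variable {S : SMTree T A} {k : ℕ}

theorem exists_endHomogeneous_lt (h : ∀ n M, S.IsRamsey n (k + 1) M) (n r t M : ℕ) :
    ∃ N, ∀ χ : (Below T (n + (k + 2)) → T) → Fin r, ∃ H ∈ S.MFix n, S.levelFun H M = N ∧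
      ∃ φ : (Below T (n + 1) → T) → Fin r, ∀ f ∈ S.AMAt n (k + 2) M, ∀ j < n + t,
        trunc f ∈ S.AMAt n 1 j → χ (H ∘ f) = φ (trunc f) := by
  induction t generalizing M with
  | zero =>
    refine ⟨M, fun χ => ⟨id, id_mem_MFix n, levelFun_id M, fun _ => χ (restr _ id),
      fun f _ j hj hf => absurd (le_of_mem_AMAt hf) (by omega)⟩⟩
  | succ t ih =>
    have := S.finite_AMAt n 1 (n + t)
    choose E hE using fun x : S.AMAt n 1 (n + t) => exists_factor_of_mem_AMAt k x.2
    obtain ⟨N₂, hN₂⟩ := (h (n + t + 1) M).exists_family (κ := Fin r) E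
    obtain ⟨N, hN⟩ := ih N₂
    refine ⟨N, fun χ => ?_⟩
    obtain ⟨H₁, hH₁, hH₁N, φ₁, hφ₁⟩ := hN χ
    obtain ⟨H₂, hH₂, hH₂M, φ₂, hφ₂⟩ := hN₂ fun f => χ (H₁ ∘ f)
    have hH₂n : H₂ ∈ S.MFix n := MFix_anti (by omega) hH₂
    refine ⟨H₁ ∘ H₂, comp_mem_MFix hH₁ hH₂n, by rw [levelFun_comp hH₁.1, hH₂M, hH₁N],
      Function.extend Subtype.val φ₂ φ₁, fun f hf j hj hfj => ?_⟩
    rcases (show j ≤ n + t by omega).eq_or_lt with rfl | hjt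
    · obtain ⟨g, hg, hgf⟩ := hE ⟨trunc f, hfj⟩ M f hf rfl
      calc χ ((H₁ ∘ H₂) ∘ f) = χ (H₁ ∘ H₂ ∘ g ∘ E ⟨trunc f, hfj⟩) := by rw [hgf]; rfl
        _ = φ₂ ⟨trunc f, hfj⟩ := hφ₂ ⟨trunc f, hfj⟩ g hg
        _ = Function.extend Subtype.val φ₂ φ₁ (trunc f) :=
          (Subtype.val_injective.extend_apply φ₂ φ₁ ⟨trunc f, hfj⟩).symm
    · have hext : Function.extend Subtype.val φ₂ φ₁ (trunc f) = φ₁ (trunc f) :=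
        Function.extend_apply' _ _ _ fun ⟨x, hx⟩ =>
          hjt.ne (eq_of_mem_AMAt_of_mem_AMAt hfj (hx ▸ x.2))
      have htrunc : trunc (H₂ ∘ f) = trunc f :=
        comp_congr_of_mem_AMAt (G := id) hfj (restr_eq_mono (restr_eq_restr_id hH₂) (by omega))
      rw [hext, ← htrunc]
      exact hφ₁ (H₂ ∘ f) (hH₂M ▸ comp_mem_AMAt hH₂n hf) j hjt (htrunc.symm ▸ hfj)

theorem exists_endHomogeneous (h : ∀ n M, S.IsRamsey n (k + 1) M) (n r M : ℕ) :
    ∃ N, ∀ χ : (Below T (n + (k + 2)) → T) → Fin r, ∃ H ∈ S.MFix n, S.levelFun H M = N ∧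
      ∃ φ : (Below T (n + 1) → T) → Fin r, ∀ f ∈ S.AMAt n (k + 2) M,
        χ (H ∘ f) = φ (trunc f) := by
  obtain ⟨N, hN⟩ := exists_endHomogeneous_lt h n r M M
  refine ⟨N, fun χ => ?_⟩
  obtain ⟨H, hH, hHM, φ, hφ⟩ := hN χ
  refine ⟨H, hH, hHM, φ, fun f hf => ?_⟩
  obtain ⟨i, hi, hfi⟩ := exists_trunc_mem_AMAt hf
  exact hφ f hf i (hi.trans_le (Nat.le_add_left M n)) hfi

theorem isRamsey_add_two (h : ∀ n M, S.IsRamsey n (k + 1) M) (n m : ℕ) :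
    S.IsRamsey n (k + 2) m := by
  intro r
  obtain ⟨M, hM⟩ := S.exists_mono_lt n m (Fin r)
  obtain ⟨N, hN⟩ := exists_endHomogeneous h n r M
  refine ⟨N, fun χ => ?_⟩
  obtain ⟨H, hH, hHM, φ, hφ⟩ := hN χ
  obtain ⟨F, hF, hFm, c, hc⟩ := hM φ
  refine ⟨H ∘ F, comp_mem_MFix hH hF, by rw [levelFun_comp hH.1, hFm, hHM], c, fun g hg => ?_⟩
  obtain ⟨i, him, hgi⟩ := exists_trunc_mem_AMAt hg
  calc χ ((H ∘ F) ∘ g) = φ (trunc (F ∘ g)) := hφ (F ∘ g) (hFm ▸ comp_mem_AMAt hF hg)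
    _ = c := hc i him (trunc g) hgi

theorem isRamsey (S : SMTree T A) (n : ℕ) : ∀ k M, S.IsRamsey n k M
  | 0, M => .of_subsingleton (subsingleton_AMAt_zero n M)
  | k + 1, M => by
    induction k generalizing n M with
    | zero => exact S.isRamsey_one n M
    | succ k ih => exact isRamsey_add_two ih n M

end Ramsey

end SMTree

end ShapeRamsey

open ShapeRamsey SMTree

theorem mainTheorem5 {T : Type*} [PartialOrder T] {A : Type*} (S : ShapeRamsey.SMTree T A)
    (n k m r : ℕ) (hk : 0 < n + k) (hm : 0 < n + m) :
    ∃ N : ℕ, ∀ χ : S.AMAt n k N → Fin r,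
      ∃ F ∈ S.AMAt n m N, ∃ c : Fin r, ∀ g ∈ S.AMAt n k (n + m - 1),
        ∃ (hg : ∀ a, ShapeRamsey.level (g a) < n + m)
          (hFg : (fun a => F ⟨g a, hg a⟩) ∈ S.AMAt n k N),
          χ ⟨fun a => F ⟨g a, hg a⟩, hFg⟩ = c := by
  rcases r.eq_zero_or_pos with rfl | hr
  · exact ⟨_, fun χ => (χ ⟨_, restr_mem_AMAt (id_mem_MFix n) (Nat.sub_add_cancel hk).symm⟩).elim0⟩
  obtain ⟨N, hN⟩ := S.isRamsey n k (n + m - 1) r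
  refine ⟨N, fun χ => ?_⟩
  obtain ⟨H, hH, rfl, c, hc⟩ := hN (Function.extend Subtype.val χ fun _ => ⟨0, hr⟩)
  refine ⟨restr (n + m) H, restr_mem_AMAt hH (Nat.sub_add_cancel hm).symm, c, fun g hg => ?_⟩
  have hHg : H ∘ g ∈ S.AMAt n k (S.levelFun H (n + m - 1)) := comp_mem_AMAt hH hg
  have hlevel : ∀ a, level (g a) < n + m := fun a =>
    (level_le_of_mem_AMAt hg a).trans_lt (Nat.sub_lt hm one_pos)
  exact ⟨hlevel, hHg, (Subtype.val_injective.extend_apply χ _ ⟨H ∘ g, hHg⟩).symm.trans (hc g hg)⟩
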